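/- Let $S^1=\mathbb R/\mathbb Z$, let $r\ge 2$ be an integer or $r=\infty$, let $d\ge 2$ be an integer, and let $E_d:S^1\to S^1$, $E_d(x)=dx \pmod 1$. Let $f:S^1\to S^1$ be a $C^r$ orientation-preserving map of degree $d$ which is expanding, i.e. there is a constant $c>1$ with $|Df(x)|>c$ for every $x\in S^1$. Call $x\in S^1$ a (Lyapunov) regular point of $f$ if the limit $$\lim_{n\to+\infty}\frac1n\log|Df^n(x)|$$ exists in $\mathbb R$, and let $\mathcal R_f$ be the set of regular points of $f$. Then $f$ is $C^r$ conjugate to $E_d$, i.e. there is a $C^r$ diffeomorphism $h:S^1\to S^1$ with $f\circ h=h\circ E_d$, if and only if $\mathcal R_f=S^1$. -/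

import Mathlib

/-- `F : ℝ → ℝ` is a (continuous) lift of the circle map `f : ℝ/ℤ → ℝ/ℤ`. -/
def IsCircleLift (F : ℝ → ℝ) (f : UnitAddCircle → UnitAddCircle) : Prop :=
  Continuous F ∧ ∀ t : ℝ, ((F t : ℝ) : UnitAddCircle) = f (t : UnitAddCircle)

/-- `f : ℝ/ℤ → ℝ/ℤ` is of class `C^r` (`r` an integer or `∞`): it has a `C^r` lift to `ℝ`. -/
def CircleContDiff (r : ℕ∞) (f : UnitAddCircle → UnitAddCircle) : Prop :=
  ∃ F : ℝ → ℝ, IsCircleLift F f ∧ ContDiff ℝ (r : WithTop ℕ∞) F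

/-- `f` has topological degree `d`: it has a lift `F` with `F (t + 1) = F t + d`.
(Two lifts differ by a constant integer, so the choice of the lift is immaterial.) -/
def CircleHasDegree (f : UnitAddCircle → UnitAddCircle) (d : ℤ) : Prop :=
  ∃ F : ℝ → ℝ, IsCircleLift F f ∧ ∀ t : ℝ, F (t + 1) = F t + d

/-- `f` preserves the orientation of the circle: it has a strictly increasing lift. -/
def CircleOrientationPreserving (f : UnitAddCircle → UnitAddCircle) : Prop :=
  ∃ F : ℝ → ℝ, IsCircleLift F f ∧ StrictMono F

/-- The derivative of a circle map at `x`, in the angular coordinate of `ℝ/ℤ`: the derivative at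
`t = 0` of the displacement `f (x + t) - f x`, read in the coordinate `(-1/2, 1/2]` near `0`. -/
noncomputable def circleDeriv (f : UnitAddCircle → UnitAddCircle) (x : UnitAddCircle) : ℝ :=
  deriv (fun t : ℝ =>
    (AddCircle.equivIoc (1 : ℝ) (-1 / 2) (f (x + (t : UnitAddCircle)) - f x) : ℝ)) 0

/-- `f` is (uniformly) expanding: `|Df| > c` everywhere, for some constant `c > 1`. -/
def CircleExpanding (f : UnitAddCircle → UnitAddCircle) : Prop :=
  ∃ c : ℝ, 1 < c ∧ ∀ x : UnitAddCircle, c < |circleDeriv f x|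

/-- `x` is a (Lyapunov) regular point of `f`: the Lyapunov exponent
`lim (1/n) log |D(f^n)(x)|` exists as a real number. -/
def IsLyapunovRegular (f : UnitAddCircle → UnitAddCircle) (x : UnitAddCircle) : Prop :=
  ∃ χ : ℝ, Filter.Tendsto (fun n : ℕ => (1 / (n : ℝ)) * Real.log |circleDeriv (f^[n]) x|)
    Filter.atTop (nhds χ)

/-- The set of regular points of `f`. -/
def regularPoints (f : UnitAddCircle → UnitAddCircle) : Set UnitAddCircle :=
  {x | IsLyapunovRegular f x}

/-- The linear model `E_d x = d x (mod 1)`. -/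
def linearExpandingMap (d : ℕ) (x : UnitAddCircle) : UnitAddCircle := d • x

/-- `f` and `g` are `C^r` conjugate: `f ∘ h = h ∘ g` for some `C^r` diffeomorphism `h`
of the circle. -/
def CircleConjugate (r : ℕ∞) (f g : UnitAddCircle → UnitAddCircle) : Prop :=
  ∃ h : UnitAddCircle ≃ₜ UnitAddCircle,
    CircleContDiff r h ∧ CircleContDiff r h.symm ∧ f ∘ h = h ∘ g

open Filter Topology

/-! If `f` is smoothly conjugate to `E_d`, the chain rule makes `D(f^n)` equal to `d ^ n` up to a
bounded factor, so every exponent is `log d`.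

Conversely, lift `f` to `F` on the line, with contracting inverse `G` and a fixed point `p`.
Exponents are constant along backward orbits, which are dense, and they are pointwise limits of
continuous functions; by Baire (`limit_eq_of_dense`) all exponents agree. So every periodic orbit
has exponent `log F'(p)`. On the line, `u = log F' ∘ G - log F'(p) + u ∘ G` always has a continuous
solution, a series along `G`-orbits. The periodic data serve, as in Livsic's theorem, to make `u`
1-periodic (`transfer_add_one`). Then `H = ∫ exp (-u)`, normalized, descends to the circle and
linearizes `F`. For smoothness, `u ∘ H⁻¹` solves an equation `v x = a x + v (x / d)`, whose
solutions are as smooth as `a` because each derivative brings a factor `1 / d`; this bootstraps `u`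
and `H` to the full regularity. -/

/-! ### Cohomological equations on the line -/

theorem exists_continuous_solution_cocycle (G a : ℝ → ℝ) (hG : Continuous G) (ha : Continuous a)
    (β : ℝ) (hs : ∀ R : ℝ, ∃ B : ℕ → ℝ, Summable B ∧
      ∀ k t, |t| ≤ R → |β ^ k * a (G^[k] t)| ≤ B k) :
    ∃ w : ℝ → ℝ, Continuous w ∧ ∀ t, w t = a t + β * w (G t) := by
  refine ⟨fun t => ∑' k : ℕ, β ^ k * a (G^[k] t), ?_, fun t => ?_⟩
  · rw [continuous_iff_continuousAt]
    intro t
    obtain ⟨B, hB, hb⟩ := hs (|t| + 1)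
    have h : ContinuousOn (fun t => ∑' k : ℕ, β ^ k * a (G^[k] t)) {s | |s| ≤ |t| + 1} := by
      refine continuousOn_tsum (fun k => ?_) hB (fun k s hs => ?_)
      · exact (continuous_const.mul (ha.comp (hG.iterate k))).continuousOn
      · rw [Real.norm_eq_abs]; exact hb k s hs
    refine h.continuousAt ?_
    filter_upwards [continuous_abs.continuousAt.eventually_lt
      (continuousAt_const (y := |t| + 1)) (by simp)] with s hs using hs.le
  · obtain ⟨B, hB, hb⟩ := hs |t|
    have hsum : Summable (fun k : ℕ => β ^ k * a (G^[k] t)) :=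
      Summable.of_norm_bounded hB (fun k => by rw [Real.norm_eq_abs]; exact hb k t le_rfl)
    simp only
    rw [hsum.tsum_eq_zero_add, ← tsum_mul_left]
    simp [Function.iterate_succ_apply, pow_succ', mul_assoc]

theorem exists_continuous_eq_add_mul_comp_div {μ : ℝ} (hμ : 1 < μ) {β : ℝ} (hβ : |β| < 1)
    {a : ℝ → ℝ} (ha : Continuous a) :
    ∃ w : ℝ → ℝ, Continuous w ∧ ∀ x, w x = a x + β * w (x / μ) := by
  refine exists_continuous_solution_cocycle (fun x => x / μ) a (by fun_prop) ha β fun R => ?_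
  obtain ⟨M, hM⟩ := (isCompact_Icc (a := -R) (b := R)).exists_bound_of_continuousOn ha.continuousOn
  refine ⟨fun k => |β| ^ k * M, (summable_geometric_of_abs_lt_one (by simpa using hβ)).mul_right M,
    fun k t ht => ?_⟩
  have hit : ∀ k : ℕ, |(fun x : ℝ => x / μ)^[k] t| ≤ R := by
    intro k
    induction k with
    | zero => simpa using ht
    | succ k ih =>
      rw [Function.iterate_succ_apply', abs_div, abs_of_pos (by linarith : (0 : ℝ) < μ)]
      exact (div_le_self (abs_nonneg _) hμ.le).trans ih
  rw [abs_mul, abs_pow]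
  exact mul_le_mul_of_nonneg_left (hM _ (abs_le.1 (hit k))) (by positivity)

/-- Iteration gives `|E x| ≤ |E (x / μ ^ n)|`, which tends to `|E 0|`. The condition at `0` excludes
the constants when `b = 1`. -/
theorem eq_of_eq_mul_comp_div {μ b : ℝ} (hμ : 1 < μ) (hb : |b| ≤ 1) {E : ℝ → ℝ}
    (hE : Continuous E) (h0 : E 0 = 0) (h : ∀ x, E x = b * E (x / μ)) (x : ℝ) : E x = 0 := by
  have hle : ∀ n : ℕ, |E x| ≤ |E (x * μ⁻¹ ^ n)| := by
    intro n
    induction n with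
    | zero => simp
    | succ n ih =>
      refine ih.trans ?_
      rw [h (x * μ⁻¹ ^ n), abs_mul]
      refine (mul_le_of_le_one_left (abs_nonneg _) hb).trans (le_of_eq ?_)
      congr 2; rw [pow_succ, div_eq_mul_inv]; ring
  have ht : Tendsto (fun n : ℕ => |E (x * μ⁻¹ ^ n)|) atTop (𝓝 0) := by
    have h1 : Tendsto (fun n : ℕ => x * μ⁻¹ ^ n) atTop (𝓝 0) := by
      simpa using (tendsto_pow_atTop_nhds_zero_of_lt_one (by positivity)
        (inv_lt_one_of_one_lt₀ hμ)).const_mul x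
    have h2 := (hE.abs.tendsto 0).comp h1
    rwa [h0, abs_zero] at h2
  exact abs_nonpos_iff.1 (ge_of_tendsto' ht hle)

/-- The formally differentiated equation has factor `b / μ`, a strict contraction even when `|b| =
1`. Its solution `w` is smooth by induction, and uniqueness identifies `v` with a primitive of `w`
up to a constant. -/
theorem contDiff_of_eq_add_mul_comp_div {μ : ℝ} (hμ : 1 < μ) (k : ℕ) :
    ∀ (b : ℝ), |b| ≤ 1 → ∀ a v : ℝ → ℝ, ContDiff ℝ k a → Continuous v →
      (∀ x, v x = a x + b * v (x / μ)) → ContDiff ℝ k v := by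
  have hμ0 : 0 < μ := by linarith
  induction k with
  | zero => intro b _ a v _ hv _; simpa using hv
  | succ k ih =>
    intro b hb a v ha hv hav
    push_cast at ha ⊢
    rw [contDiff_succ_iff_deriv] at ha
    obtain ⟨had, -, ha'⟩ := ha
    have hbμ : |b / μ| < 1 := by
      rw [abs_div, abs_of_pos hμ0, div_lt_one hμ0]; linarith
    obtain ⟨w, hw, hwe⟩ := exists_continuous_eq_add_mul_comp_div hμ hbμ ha'.continuous
    have hwk := ih (b / μ) hbμ.le _ w ha' hw hwe
    have hW : ∀ x, HasDerivAt (fun x => ∫ s in (0 : ℝ)..x, w s) (w x) x := fun x =>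
      intervalIntegral.integral_hasDerivAt_right (hw.intervalIntegrable _ _)
        (hw.stronglyMeasurableAtFilter _ _) hw.continuousAt
    set W : ℝ → ℝ := fun x => ∫ s in (0 : ℝ)..x, w s with hWdef
    have hconst : ∀ x, HasDerivAt (fun x => W x - (a x + b * W (x / μ))) 0 x := by
      intro x
      have h1 : HasDerivAt (fun x => W (x / μ)) (w (x / μ) * (1 / μ)) x :=
        HasDerivAt.comp (h₂ := W) x (hW (x / μ)) ((hasDerivAt_id x).div_const μ)
      refine ((hW x).sub ((had x).hasDerivAt.add (h1.const_mul b))).congr_deriv ?_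
      rw [hwe x]; ring
    have hW0 : W 0 = 0 := by simp [hWdef]
    have hce : ∀ x, W x - (a x + b * W (x / μ)) = - a 0 := by
      intro x
      have := is_const_of_deriv_eq_zero (fun x => (hconst x).differentiableAt)
        (fun x => (hconst x).deriv) x 0
      simpa [hW0] using this
    have hWc : Continuous W := continuous_iff_continuousAt.2 fun x => (hW x).continuousAt
    have hE := eq_of_eq_mul_comp_div hμ hb (E := fun x => v x - W x - v 0) (by fun_prop)
      (by simp [hW0]) (fun x => by
        have h1 := hav x
        have h2 := hce x
        have h3 := hav 0
        rw [zero_div] at h3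
        linear_combination h1 - h2 - h3)
    have hveq : v = fun x => W x + v 0 := by
      ext x; linear_combination hE x
    have hvd : ∀ x, HasDerivAt v (w x) x := by
      intro x; rw [hveq]; exact (hW x).add_const _
    rw [contDiff_succ_iff_deriv]
    refine ⟨fun x => (hvd x).differentiableAt, by simp, ?_⟩
    rwa [show deriv v = w from funext fun x => (hvd x).deriv]

/-! ### Baire category -/

theorem limit_eq_of_dense {X : Type*} [TopologicalSpace X] [BaireSpace X] [Nonempty X]
    {A : ℕ → X → ℝ} (hA : ∀ n, Continuous (A n)) {χ : X → ℝ}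
    (hχ : ∀ x, Tendsto (fun n => A n x) atTop (𝓝 (χ x))) {α β : ℝ}
    (hα : Dense {x | χ x = α}) (hβ : Dense {x | χ x = β}) : α = β := by
  by_contra hne
  have hpos : 0 < |α - β| := abs_pos.2 (sub_ne_zero.2 hne)
  -- Four errors, each at most `ε`, will separate `α` from `β`: two from the limit to `A N`, two
  -- from the variation of `A N`.
  set ε := |α - β| / 5 with hε
  have hε0 : 0 < ε := by positivity
  let K : ℕ → Set X := fun N => {x | ∀ n ≥ N, |A n x - A N x| ≤ ε}
  have hK : ∀ N, IsClosed (K N) := by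
    intro N
    have : K N = ⋂ n, ⋂ (_ : n ≥ N), {x | |A n x - A N x| ≤ ε} := by
      ext x; simp [K]
    rw [this]
    exact isClosed_iInter fun n => isClosed_iInter fun _ =>
      isClosed_le (((hA n).sub (hA N)).abs) continuous_const
  have hU : ⋃ N, K N = Set.univ := by
    refine Set.eq_univ_of_forall fun x => Set.mem_iUnion.2 ?_
    obtain ⟨N, hN⟩ := Metric.cauchySeq_iff'.1 (hχ x).cauchySeq ε hε0
    exact ⟨N, fun n hn => (hN n hn).le⟩
  obtain ⟨N, hN⟩ := nonempty_interior_of_iUnion_of_closed hK hU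
  have hcl : ∀ x ∈ K N, |χ x - A N x| ≤ ε := fun x hx =>
    le_of_tendsto ((hχ x).sub_const _).abs (eventually_atTop.2 ⟨N, fun n hn => hx n hn⟩)
  obtain ⟨x, hxN⟩ := hN
  have hV : IsOpen (interior (K N) ∩ {y | |A N y - A N x| < ε}) :=
    isOpen_interior.inter (isOpen_lt (((hA N).sub continuous_const).abs) continuous_const)
  have hVne : (interior (K N) ∩ {y | |A N y - A N x| < ε}).Nonempty := ⟨x, hxN, by simpa using hε0⟩
  obtain ⟨y, hy, hya⟩ := hα.inter_open_nonempty _ hV hVne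
  obtain ⟨z, hz, hzb⟩ := hβ.inter_open_nonempty _ hV hVne
  have h1 := abs_le.1 (hcl y (interior_subset hy.1))
  have h2 := abs_le.1 (hcl z (interior_subset hz.1))
  have h3 := abs_lt.1 (show |A N y - A N x| < ε from hy.2)
  have h4 := abs_lt.1 (show |A N z - A N x| < ε from hz.2)
  simp only [Set.mem_ofPred_eq] at hya hzb
  rw [hya] at h1
  rw [hzb] at h2
  have : |α - β| < 5 * ε := by rw [abs_lt]; constructor <;> linarith
  rw [hε] at this
  linarith

/-! ### Expanding lifts and their contracting inverses -/

theorem surjective_of_add_one {F : ℝ → ℝ} (hF : Continuous F) {a : ℝ} (ha : 0 < a)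
    (h : ∀ t, F (t + 1) = F t + a) : Function.Surjective F := by
  have hp : ∀ n : ℕ, F n = F 0 + n * a := by
    intro n
    induction n with
    | zero => simp
    | succ n ih => push_cast; rw [h, ih]; ring
  have hn : ∀ n : ℕ, F (-n) = F 0 - n * a := by
    intro n
    induction n with
    | zero => simp
    | succ n ih =>
      have := h (-(n + 1 : ℕ))
      rw [show (-((n + 1 : ℕ) : ℝ)) + 1 = -n by push_cast; ring, ih] at this
      push_cast at this ⊢
      linarith
  intro y
  obtain ⟨n, hn1⟩ := exists_nat_ge (|y - F 0| / a)
  rw [div_le_iff₀ ha] at hn1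
  have h1 := abs_le.1 hn1
  exact mem_range_of_exists_le_of_exists_ge hF ⟨-n, by rw [hn]; linarith⟩
    ⟨n, by rw [hp]; linarith⟩

/-- `F : ℝ → ℝ` is a bijective `C²` lift, with inverse `G`, of a circle map of degree `d`
with derivative greater than `c > 1`. -/
structure IsExpandingLift (d : ℕ) (c : ℝ) (F G : ℝ → ℝ) : Prop where
  one_lt : 1 < c
  contDiff : ContDiff ℝ 2 F
  map_add_one : ∀ t, F (t + 1) = F t + d
  lt_deriv : ∀ t, c < deriv F t
  left_inv : ∀ t, G (F t) = t
  right_inv : ∀ t, F (G t) = t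

namespace IsExpandingLift

variable {d : ℕ} {c : ℝ} {F G : ℝ → ℝ}

theorem differentiable (h : IsExpandingLift d c F G) : Differentiable ℝ F :=
  h.contDiff.differentiable (by norm_num)

theorem deriv_pos (h : IsExpandingLift d c F G) (t : ℝ) : 0 < deriv F t := by
  linarith [h.one_lt, h.lt_deriv t]

theorem map_add_int (h : IsExpandingLift d c F G) (t : ℝ) (m : ℤ) : F (t + m) = F t + d * m := by
  induction m with
  | zero => simp
  | succ n ih => push_cast at ih ⊢; rw [← add_assoc, h.map_add_one, ih]; ring
  | pred n ih =>
    have := h.map_add_one (t + (-(n : ℤ) - 1 : ℤ))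
    push_cast at ih this ⊢
    rw [show t + (-(n : ℝ) - 1) + 1 = t + -(n : ℝ) by ring, ih] at this
    linarith

theorem iterate_add_int (h : IsExpandingLift d c F G) (k : ℕ) (t : ℝ) (m : ℤ) :
    F^[k] (t + m) = F^[k] t + (d : ℝ) ^ k * m := by
  induction k with
  | zero => simp
  | succ k ih =>
    have := h.map_add_int (F^[k] t) ((d : ℤ) ^ k * m)
    push_cast at this
    rw [Function.iterate_succ_apply', Function.iterate_succ_apply', ih, this]
    ring

theorem inv_iterate (h : IsExpandingLift d c F G) (k : ℕ) (t : ℝ) : G^[k] (F^[k] t) = t :=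
  (Function.LeftInverse.iterate h.left_inv k) t

theorem iterate_inv (h : IsExpandingLift d c F G) (k : ℕ) (t : ℝ) : F^[k] (G^[k] t) = t :=
  (Function.RightInverse.iterate h.right_inv k) t

theorem deriv_add_int (h : IsExpandingLift d c F G) (t : ℝ) (m : ℤ) :
    deriv F (t + m) = deriv F t := by
  have : (fun s => F (s + m)) = fun s => F s + d * m := funext fun s => h.map_add_int s m
  rw [← deriv_comp_add_const, this, deriv_add_const]

theorem dist_inv_le (h : IsExpandingLift d c F G) (s t : ℝ) : |G s - G t| ≤ c⁻¹ * |s - t| := by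
  have hc : 0 < c := by linarith [h.one_lt]
  have key : ∀ x y : ℝ, x ≤ y → c * (y - x) ≤ F y - F x := fun x y hxy =>
    mul_sub_le_image_sub_of_le_deriv h.differentiable (fun t => (h.lt_deriv t).le) hxy
  rw [inv_mul_eq_div, le_div_iff₀ hc]
  rcases le_total (G s) (G t) with hst | hst
  · have := key _ _ hst
    rw [h.right_inv, h.right_inv] at this
    rw [abs_sub_comm, abs_of_nonneg (sub_nonneg.2 hst), abs_sub_comm]
    linarith [le_abs_self (t - s)]
  · have := key _ _ hst
    rw [h.right_inv, h.right_inv] at this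
    rw [abs_of_nonneg (sub_nonneg.2 hst)]
    linarith [le_abs_self (s - t)]

theorem dist_inv_iterate_le (h : IsExpandingLift d c F G) (k : ℕ) (s t : ℝ) :
    |G^[k] s - G^[k] t| ≤ c⁻¹ ^ k * |s - t| := by
  have hc : 0 < c := by linarith [h.one_lt]
  induction k with
  | zero => simp
  | succ k ih =>
    rw [Function.iterate_succ_apply', Function.iterate_succ_apply', pow_succ', mul_assoc]
    exact (h.dist_inv_le _ _).trans (mul_le_mul_of_nonneg_left ih (by positivity))

theorem tendsto_inv_pow (h : IsExpandingLift d c F G) :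
    Tendsto (fun k : ℕ => c⁻¹ ^ k) atTop (𝓝 0) :=
  tendsto_pow_atTop_nhds_zero_of_lt_one (by have := h.one_lt; positivity)
    (inv_lt_one_of_one_lt₀ h.one_lt)

theorem continuous_inv (h : IsExpandingLift d c F G) : Continuous G := by
  have hc : 0 < c := by linarith [h.one_lt]
  exact (LipschitzWith.of_dist_le_mul (K := Real.toNNReal c⁻¹) (fun s t => by
    rw [Real.coe_toNNReal _ (by positivity)]
    exact h.dist_inv_le s t)).continuous

/-- Banach's fixed point theorem. For integer `q`, the point `G^[n] y` satisfies `F^[n] x = x + q`,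
so it projects to a periodic point of the circle map. -/
theorem exists_fixed_inv_iterate_add (h : IsExpandingLift d c F G) {n : ℕ} (hn : n ≠ 0) (q : ℝ) :
    ∃ y, G^[n] y + q = y := by
  have hc : 0 < c := by linarith [h.one_lt]
  have hlip : ContractingWith (Real.toNNReal (c⁻¹ ^ n)) (fun y => G^[n] y + q) := by
    refine ⟨?_, LipschitzWith.of_dist_le_mul fun s t => ?_⟩
    · rw [Real.toNNReal_lt_one]
      exact pow_lt_one₀ (by positivity) (inv_lt_one_of_one_lt₀ h.one_lt) hn
    · rw [Real.coe_toNNReal _ (by positivity), dist_add_right]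
      exact h.dist_inv_iterate_le n s t
  exact ⟨_, hlip.fixedPoint_isFixedPt⟩

theorem exists_fixed (h : IsExpandingLift d c F G) : ∃ p, F p = p := by
  obtain ⟨p, hp⟩ := h.exists_fixed_inv_iterate_add one_ne_zero 0
  refine ⟨p, ?_⟩
  have := h.right_inv p
  simpa [show G p = p by simpa using hp] using this

theorem contDiff_log_deriv (h : IsExpandingLift d c F G) {k : ℕ} (hF : ContDiff ℝ (k + 1) F) :
    ContDiff ℝ k (fun t => Real.log (deriv F t)) :=
  (contDiff_succ_iff_deriv.1 hF).2.2.log fun t => (h.deriv_pos t).ne'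

theorem continuous_log_deriv (h : IsExpandingLift d c F G) :
    Continuous (fun t => Real.log (deriv F t)) :=
  (h.contDiff_log_deriv (k := 1) (by simpa [one_add_one_eq_two] using h.contDiff)).continuous

theorem exists_lipschitz_log_deriv (h : IsExpandingLift d c F G) :
    ∃ L : ℝ, 0 ≤ L ∧ ∀ s t, |Real.log (deriv F s) - Real.log (deriv F t)| ≤ L * |s - t| := by
  have hC := h.contDiff_log_deriv (k := 1) (by simpa [one_add_one_eq_two] using h.contDiff)
  set φ : ℝ → ℝ := fun t => Real.log (deriv F t) with hφ
  have hper : ∀ t (m : ℤ), deriv φ (t + m) = deriv φ t := by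
    intro t m
    rw [← deriv_comp_add_const]
    congr 1; ext s; simp only [hφ, h.deriv_add_int]
  obtain ⟨M, hM⟩ := (isCompact_Icc (a := (0 : ℝ)) (b := 1)).exists_bound_of_continuousOn
    (hC.continuous_deriv (by simp)).continuousOn
  have hb : ∀ t, ‖deriv φ t‖ ≤ M := by
    intro t
    rw [← Int.fract_add_floor t, hper]
    exact hM _ ⟨Int.fract_nonneg t, (Int.fract_lt_one t).le⟩
  refine ⟨M, (norm_nonneg _).trans (hb 0), fun s t => ?_⟩
  exact convex_univ.norm_image_sub_le_of_norm_deriv_le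
    (fun x _ => hC.differentiable (by simp) x) (fun x _ => hb x) (Set.mem_univ t) (Set.mem_univ s)

/-! ### Birkhoff sums and Lyapunov exponents -/

theorem hasDerivAt_iterate (h : IsExpandingLift d c F G) (n : ℕ) (t : ℝ) :
    HasDerivAt F^[n] (∏ k ∈ Finset.range n, deriv F (F^[k] t)) t := by
  induction n with
  | zero => simpa using hasDerivAt_id t
  | succ n ih =>
    rw [Function.iterate_succ', Finset.prod_range_succ, mul_comm]
    exact (h.differentiable _).hasDerivAt.comp t ih

theorem log_abs_deriv_iterate (h : IsExpandingLift d c F G) (n : ℕ) (t : ℝ) :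
    Real.log |deriv F^[n] t| = birkhoffSum F (fun t => Real.log (deriv F t)) n t := by
  rw [(h.hasDerivAt_iterate n t).deriv, Real.log_abs,
    Real.log_prod fun k _ => (h.deriv_pos _).ne']
  rfl

theorem birkhoffSum_add_int (h : IsExpandingLift d c F G) (n : ℕ) (t : ℝ) (m : ℤ) :
    birkhoffSum F (fun t => Real.log (deriv F t)) n (t + m) =
      birkhoffSum F (fun t => Real.log (deriv F t)) n t := by
  refine Finset.sum_congr rfl fun k _ => ?_
  have := h.deriv_add_int (F^[k] t) ((d : ℤ) ^ k * m)
  push_cast at this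
  rw [h.iterate_add_int]
  simp only [this]

theorem continuous_birkhoffSum (h : IsExpandingLift d c F G) (n : ℕ) :
    Continuous (birkhoffSum F (fun t => Real.log (deriv F t)) n) := by
  unfold birkhoffSum
  exact continuous_finsetSum _ fun k _ =>
    h.continuous_log_deriv.comp (h.differentiable.continuous.iterate k)

/-- Some integer translate of `x` lies within `1` of `F^[j] t`; pulling it back by `G^[j]` brings it
within `c⁻¹ ^ j` of `t`. -/
theorem dense_preimages (h : IsExpandingLift d c F G) (x : ℝ) :
    Dense {t : ℝ | ∃ (j : ℕ) (i : ℤ), F^[j] t = x + i} := by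
  rw [Metric.dense_iff]
  intro t ε hε
  obtain ⟨j, hj⟩ := (h.tendsto_inv_pow.eventually_lt_const hε).exists
  have hc : 0 < c := by linarith [h.one_lt]
  refine ⟨G^[j] (x + ⌊F^[j] t - x⌋), ?_, j, ⌊F^[j] t - x⌋, h.iterate_inv _ _⟩
  rw [Metric.mem_ball, Real.dist_eq]
  nth_rewrite 2 [← h.inv_iterate j t]
  refine (h.dist_inv_iterate_le _ _ _).trans_lt (lt_of_le_of_lt ?_ hj)
  refine mul_le_of_le_one_right (by positivity) ?_
  rw [abs_le]
  constructor <;> linarith [Int.floor_le (F^[j] t - x), Int.lt_floor_add_one (F^[j] t - x)]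

theorem tendsto_birkhoff_of_iterate_eq (h : IsExpandingLift d c F G) {j : ℕ} {t x χ : ℝ} {i : ℤ}
    (hj : F^[j] t = x + i)
    (hx : Tendsto (fun n : ℕ => 1 / (n : ℝ) * birkhoffSum F (fun t => Real.log (deriv F t)) n t)
      atTop (𝓝 χ)) :
    Tendsto (fun n : ℕ => 1 / (n : ℝ) * birkhoffSum F (fun t => Real.log (deriv F t)) n x)
      atTop (𝓝 χ) := by
  have h1 := (tendsto_add_atTop_iff_nat j).2 hx
  have h2 : Tendsto (fun n : ℕ => ((n + j : ℕ) : ℝ) / n) atTop (𝓝 1) := by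
    have h3 : Tendsto (fun n : ℕ => 1 + (j : ℝ) / n) atTop (𝓝 (1 + 0)) :=
      (tendsto_const_div_atTop_nhds_zero_nat _).const_add 1
    rw [add_zero] at h3
    refine h3.congr' ?_
    filter_upwards [eventually_gt_atTop 0] with n hn
    have : (n : ℝ) ≠ 0 := by positivity
    push_cast; field_simp
  have h4 : Tendsto (fun n : ℕ => birkhoffSum F (fun t => Real.log (deriv F t)) j t / n) atTop
      (𝓝 0) := tendsto_const_div_atTop_nhds_zero_nat _
  have h5 := (h2.mul h1).sub h4
  rw [one_mul, sub_zero] at h5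
  refine h5.congr' ?_
  filter_upwards [eventually_gt_atTop 0] with n hn
  have : (n : ℝ) ≠ 0 := by positivity
  have : ((n + j : ℕ) : ℝ) ≠ 0 := by positivity
  rw [show birkhoffSum F (fun t => Real.log (deriv F t)) (n + j) t =
    birkhoffSum F (fun t => Real.log (deriv F t)) j t +
      birkhoffSum F (fun t => Real.log (deriv F t)) n x by
      rw [add_comm n j, birkhoffSum_add, hj, h.birkhoffSum_add_int]]
  field_simp
  ring

theorem birkhoffSum_mul_of_periodic (h : IsExpandingLift d c F G) {n : ℕ} {x : ℝ} {m : ℤ}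
    (hx : F^[n] x = x + m) (j : ℕ) :
    birkhoffSum F (fun t => Real.log (deriv F t)) (n * j) x =
      j * birkhoffSum F (fun t => Real.log (deriv F t)) n x := by
  induction j with
  | zero => simp
  | succ j ih =>
    rw [mul_add_one, add_comm, birkhoffSum_add, hx, h.birkhoffSum_add_int, ih]
    push_cast; ring

/-- The level set of `χ` through any point contains its dense backward orbit, so Baire forces `χ p =
χ x`. At a periodic point the exponent is the average over one period. -/
theorem birkhoffSum_eq_of_forall_regular (h : IsExpandingLift d c F G)
    (hreg : ∀ t, ∃ χ : ℝ, Tendsto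
      (fun n : ℕ => 1 / (n : ℝ) * birkhoffSum F (fun t => Real.log (deriv F t)) n t)
      atTop (𝓝 χ)) {p : ℝ} (hp : F p = p) {n : ℕ} {x : ℝ} {m : ℤ} (hx : F^[n] x = x + m) :
    birkhoffSum F (fun t => Real.log (deriv F t)) n x = n * Real.log (deriv F p) := by
  choose χ hχ using hreg
  have hdense : ∀ y, Dense {t | χ t = χ y} := fun y =>
    (h.dense_preimages y).mono <| by
      rintro t ⟨j, i, hj⟩
      exact tendsto_nhds_unique (h.tendsto_birkhoff_of_iterate_eq hj (hχ t)) (hχ y)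
  have heq : χ p = χ x := limit_eq_of_dense
    (fun n => continuous_const.mul (h.continuous_birkhoffSum n)) hχ (hdense p) (hdense x)
  have hper : ∀ {n : ℕ} {x : ℝ} {m : ℤ}, n ≠ 0 → F^[n] x = x + m →
      birkhoffSum F (fun t => Real.log (deriv F t)) n x = n * χ x := by
    intro n x m hn hx
    have hn' : (n : ℝ) ≠ 0 := by positivity
    have h1 : Tendsto (fun j : ℕ => n * j) atTop atTop :=
      tendsto_id.const_mul_atTop' (Nat.pos_of_ne_zero hn)
    have h2 := (hχ x).comp h1
    have h3 : Tendsto (fun _ : ℕ => birkhoffSum F (fun t => Real.log (deriv F t)) n x / n)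
        atTop (𝓝 (χ x)) := by
      refine h2.congr' ?_
      filter_upwards [eventually_gt_atTop 0] with j hj
      have : (j : ℝ) ≠ 0 := by positivity
      simp only [Function.comp]
      rw [h.birkhoffSum_mul_of_periodic hx]
      push_cast; field_simp
    have h4 := tendsto_nhds_unique h3 tendsto_const_nhds
    rw [h4]; field_simp
  rcases eq_or_ne n 0 with rfl | hn
  · simp
  have h1 := hper (n := 1) (x := p) (m := 0) one_ne_zero (by simpa using hp)
  rw [hper hn hx, ← heq]
  simp at h1
  rw [h1]

/-! ### The transfer function and its periodicity -/

/-- `G`-orbits approach `p` geometrically and `log F'` is Lipschitz, so the series converges locally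
uniformly. Regularity of all points is not needed here. -/
theorem exists_continuous_transfer (h : IsExpandingLift d c F G) {p : ℝ} (hp : F p = p) :
    ∃ u : ℝ → ℝ, Continuous u ∧ u p = 0 ∧
      ∀ t, u t = Real.log (deriv F (G t)) - Real.log (deriv F p) + u (G t) := by
  obtain ⟨L, hL0, hL⟩ := h.exists_lipschitz_log_deriv
  have hc : 0 < c := by linarith [h.one_lt]
  have hGp : G p = p := by simpa [hp] using h.left_inv p
  have hGk : ∀ k, G^[k] p = p := fun k => Function.iterate_fixed hGp k
  obtain ⟨w, hw, hwe⟩ := exists_continuous_solution_cocycle G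
    (fun t => Real.log (deriv F (G t)) - Real.log (deriv F p)) h.continuous_inv
    ((h.continuous_log_deriv.comp h.continuous_inv).sub continuous_const) 1 (by
      intro R
      refine ⟨fun k => c⁻¹ ^ k * (L * (R + |p|)), (summable_geometric_of_lt_one (by positivity)
        (inv_lt_one_of_one_lt₀ h.one_lt)).mul_right _, fun k t ht => ?_⟩
      rw [one_pow, one_mul]
      have h1 := h.dist_inv_iterate_le (k + 1) t p
      rw [hGk, Function.iterate_succ_apply'] at h1
      have h2 : |t - p| ≤ R + |p| := (abs_sub t p).trans (by linarith)
      have h3 : c⁻¹ ^ (k + 1) ≤ c⁻¹ ^ k :=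
        pow_le_pow_of_le_one (by positivity) (inv_le_one_of_one_le₀ h.one_lt.le) (by simp)
      calc _ ≤ L * |G (G^[k] t) - p| := hL _ _
        _ ≤ L * (c⁻¹ ^ k * (R + |p|)) := by gcongr; exact h1.trans (by gcongr)
        _ = _ := by ring)
  refine ⟨fun t => w t - w p, hw.sub continuous_const, by simp, fun t => ?_⟩
  simp only
  rw [hwe t]; ring

theorem transfer_eq_sum (h : IsExpandingLift d c F G) {p : ℝ} {u : ℝ → ℝ}
    (hu : ∀ t, u t = Real.log (deriv F (G t)) - Real.log (deriv F p) + u (G t))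
    (n : ℕ) (t : ℝ) :
    u (F^[n] t) = birkhoffSum F (fun t => Real.log (deriv F t)) n t
      - n * Real.log (deriv F p) + u t := by
  induction n with
  | zero => simp
  | succ n ih =>
    rw [Function.iterate_succ_apply', hu, h.left_inv, ih, birkhoffSum_succ]
    push_cast; ring

/-- The points `y n` tend to `p + m` while `x n = G^[n + 1] (y n)` tends to `p`. Each `x n` is
periodic on the circle, so its Birkhoff sum cancels and `u (y n) = u (x n)`; then pass to the limit.
-/
theorem transfer_add_int (h : IsExpandingLift d c F G)
    (hreg : ∀ t, ∃ χ : ℝ, Tendsto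
      (fun n : ℕ => 1 / (n : ℝ) * birkhoffSum F (fun t => Real.log (deriv F t)) n t)
      atTop (𝓝 χ)) {p : ℝ} (hp : F p = p) {u : ℝ → ℝ} (huc : Continuous u) (hup : u p = 0)
    (hu : ∀ t, u t = Real.log (deriv F (G t)) - Real.log (deriv F p) + u (G t)) (m : ℤ) :
    u (p + m) = 0 := by
  have hc : 0 < c := by linarith [h.one_lt]
  have hc1 : c⁻¹ < 1 := inv_lt_one_of_one_lt₀ h.one_lt
  have hGp : G p = p := by simpa [hp] using h.left_inv p
  have hGk : ∀ k, G^[k] p = p := fun k => Function.iterate_fixed hGp k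
  have hex : ∀ n : ℕ, ∃ y, G^[n + 1] y + m = y := fun n =>
    h.exists_fixed_inv_iterate_add (by simp) m
  choose y hy using hex
  have huy : ∀ n, u (y n) = u (G^[n + 1] (y n)) := by
    intro n
    have h1 : F^[n + 1] (G^[n + 1] (y n)) = G^[n + 1] (y n) + m := by rw [h.iterate_inv, hy]
    have h2 := h.transfer_eq_sum hu (n + 1) (G^[n + 1] (y n))
    rw [h.birkhoffSum_eq_of_forall_regular hreg hp h1, h.iterate_inv] at h2
    linarith
  have hb : ∀ n, |y n - p| ≤ |(m : ℝ)| / (1 - c⁻¹) := by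
    intro n
    rw [le_div_iff₀ (by linarith)]
    have h1 := h.dist_inv_iterate_le (n + 1) (y n) p
    rw [hGk] at h1
    have h2 : c⁻¹ ^ (n + 1) ≤ c⁻¹ := pow_le_of_le_one (by positivity) hc1.le (by simp)
    have h3 : |y n - p| ≤ |G^[n + 1] (y n) - p| + |(m : ℝ)| := by
      rw [show y n - p = (G^[n + 1] (y n) - p) + m by linarith [hy n]]
      simpa using abs_add_le (G^[n + 1] (y n) - p) (m : ℝ)
    have h4 := mul_le_mul_of_nonneg_right h2 (abs_nonneg (y n - p))
    linarith
  have hGy : Tendsto (fun n => G^[n + 1] (y n)) atTop (𝓝 p) := by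
    rw [tendsto_iff_dist_tendsto_zero]
    have h1 : Tendsto (fun n : ℕ => c⁻¹ ^ (n + 1) * (|(m : ℝ)| / (1 - c⁻¹))) atTop (𝓝 0) := by
      simpa using ((tendsto_add_atTop_iff_nat 1).2 h.tendsto_inv_pow).mul_const
        (|(m : ℝ)| / (1 - c⁻¹))
    refine squeeze_zero (fun _ => dist_nonneg) (fun n => ?_) h1
    rw [Real.dist_eq]
    have h2 := h.dist_inv_iterate_le (n + 1) (y n) p
    rw [hGk] at h2
    exact h2.trans (mul_le_mul_of_nonneg_left (hb n) (by positivity))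
  have hyl : Tendsto y atTop (𝓝 (p + m)) := (hGy.add_const (m : ℝ)).congr hy
  have h1 := (huc.tendsto _).comp hyl
  have h2 := (huc.tendsto _).comp hGy
  rw [hup] at h2
  exact tendsto_nhds_unique h1 (h2.congr fun n => (huy n).symm)

/-- On the dense set where `F^[j] t = p + i`, both `F^[j] t` and `F^[j] (t + 1)` are integer
translates of `p`, where `u` vanishes; the Birkhoff sums at `t` and `t + 1` agree. -/
theorem transfer_add_one (h : IsExpandingLift d c F G)
    (hreg : ∀ t, ∃ χ : ℝ, Tendsto
      (fun n : ℕ => 1 / (n : ℝ) * birkhoffSum F (fun t => Real.log (deriv F t)) n t)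
      atTop (𝓝 χ)) {p : ℝ} (hp : F p = p) {u : ℝ → ℝ} (huc : Continuous u) (hup : u p = 0)
    (hu : ∀ t, u t = Real.log (deriv F (G t)) - Real.log (deriv F p) + u (G t)) (t : ℝ) :
    u (t + 1) = u t := by
  refine congrFun (Continuous.ext_on (h.dense_preimages p) (f := fun t => u (t + 1)) (g := u)
    (by fun_prop) huc ?_) t
  rintro t ⟨j, i, hj⟩
  have h1 := h.transfer_eq_sum hu j t
  have h2 := h.transfer_eq_sum hu j (t + (1 : ℤ))
  have h3 := h.transfer_add_int hreg hp huc hup hu i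
  have h4 := h.transfer_add_int hreg hp huc hup hu (i + d ^ j)
  rw [hj, h3] at h1
  rw [h.iterate_add_int, hj, h.birkhoffSum_add_int] at h2
  push_cast at h2 h4
  rw [show p + i + (d : ℝ) ^ j * 1 = p + (i + d ^ j) by ring, h4] at h2
  simp only
  linarith

end IsExpandingLift

/-! ### Linearization and its regularity -/

namespace IsExpandingLift

variable {d : ℕ} {c : ℝ} {F G : ℝ → ℝ}

/-- The equation for `u` says `exp (-u (F t)) * F' t = F' p * exp (-u t)`; integrated from `p`, it
makes the primitive of `exp (-u)` an eigenfunction of composition with `F`. -/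
theorem exists_linearization (h : IsExpandingLift d c F G) {p : ℝ} (hp : F p = p)
    {u : ℝ → ℝ} (huc : Continuous u)
    (hu : ∀ t, u t = Real.log (deriv F (G t)) - Real.log (deriv F p) + u (G t))
    (hu1 : ∀ t, u (t + 1) = u t) :
    ∃ (H : ℝ ≃ₜ ℝ) (a : ℝ), 0 < a ∧ (∀ t, HasDerivAt H (Real.exp (-u t) / a) t) ∧
      (∀ t, H (t + 1) = H t + 1) ∧ ∀ t, H (F t) = d * H t := by
  have hec : Continuous fun t => Real.exp (-u t) := by fun_prop
  set I : ℝ → ℝ := fun x => ∫ s in p..x, Real.exp (-u s) with hI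
  have hId : ∀ x, HasDerivAt I (Real.exp (-u x)) x := fun x =>
    intervalIntegral.integral_hasDerivAt_right (hec.intervalIntegrable _ _)
      (hec.stronglyMeasurableAtFilter _ _) hec.continuousAt
  have hIp : I p = 0 := by simp [hI]
  have hImono : StrictMono I := strictMono_of_hasDerivAt_pos hId fun _ => Real.exp_pos _
  set a := I (p + 1) with ha_def
  have ha : 0 < a := by rw [← hIp]; exact hImono (by linarith)
  have hI1 : ∀ t, I (t + 1) = I t + a := by
    intro t
    have hd : ∀ t, HasDerivAt (fun t => I (t + 1) - I t) 0 t := fun t =>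
      (((hId (t + 1)).comp_add_const t 1).sub (hId t)).congr_deriv (by rw [hu1, sub_self])
    have := is_const_of_deriv_eq_zero (fun x => (hd x).differentiableAt) (fun x => (hd x).deriv) t p
    simp only [hIp] at this
    linarith
  have hIF : ∀ t, I (F t) = deriv F p * I t := by
    intro t
    have hd : ∀ t, HasDerivAt (fun t => I (F t) - deriv F p * I t) 0 t := by
      intro t
      refine ((HasDerivAt.comp (h₂ := I) t (hId (F t)) (h.differentiable t).hasDerivAt).sub
        ((hId t).const_mul (deriv F p))).congr_deriv ?_
      rw [hu (F t), h.left_inv, show -(Real.log (deriv F t) - Real.log (deriv F p) + u t) =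
        -Real.log (deriv F t) + Real.log (deriv F p) + -u t by ring, Real.exp_add, Real.exp_add,
        Real.exp_neg, Real.exp_log (h.deriv_pos t), Real.exp_log (h.deriv_pos p)]
      have := (h.deriv_pos t).ne'
      field_simp
      ring
    have := is_const_of_deriv_eq_zero (fun x => (hd x).differentiableAt) (fun x => (hd x).deriv) t p
    simp only [hp, hIp] at this
    linarith
  have hHd : ∀ t, HasDerivAt (fun t => I t / a) (Real.exp (-u t) / a) t := fun t =>
    (hId t).div_const a
  have hHc : Continuous fun t => I t / a :=
    continuous_iff_continuousAt.2 fun t => (hHd t).continuousAt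
  have hH1 : ∀ t, I (t + 1) / a = I t / a + 1 := fun t => by rw [hI1]; field_simp
  have hHmono : StrictMono fun t => I t / a := fun s t hst => div_lt_div_of_pos_right (hImono hst) ha
  let H : ℝ ≃ₜ ℝ := (hHmono.orderIsoOfSurjective _
    (surjective_of_add_one hHc one_pos hH1)).toHomeomorph
  -- Evaluate the eigenfunction equation at `p + 1`, using `F (p + 1) = p + d`.
  have hμ : deriv F p = d := by
    have h1 := hIF (p + 1)
    have h2 : ∀ n : ℕ, I (p + n) = n * a := by
      intro n
      induction n with
      | zero => simp [hIp]
      | succ n ih => push_cast; rw [← add_assoc, hI1, ih]; ring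
    rw [h.map_add_one, hp, h2, ← ha_def] at h1
    exact (mul_right_cancel₀ ha.ne' h1).symm
  refine ⟨H, a, ha, hHd, hH1, fun t => ?_⟩
  change I (F t) / a = d * (I t / a)
  rw [hIF, hμ]; ring

theorem contDiff_linearization (h : IsExpandingLift d c F G) (hd : 2 ≤ d) {p : ℝ}
    {u : ℝ → ℝ} (huc : Continuous u)
    (hu : ∀ t, u t = Real.log (deriv F (G t)) - Real.log (deriv F p) + u (G t))
    {H : ℝ ≃ₜ ℝ} {a : ℝ} (ha : 0 < a) (hH : ∀ t, HasDerivAt H (Real.exp (-u t) / a) t)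
    (hHF : ∀ t, H (F t) = d * H t) (k : ℕ) (hF : ContDiff ℝ (k + 1) F) :
    ContDiff ℝ (k + 1) H := by
  have hd1 : (1 : ℝ) < d := by exact_mod_cast hd
  have hderiv : deriv H = fun t => Real.exp (-u t) / a := funext fun t => (hH t).deriv
  suffices hk : ContDiff ℝ k u by
    rw [contDiff_succ_iff_deriv]
    refine ⟨fun t => (hH t).differentiableAt, by simp, ?_⟩
    rw [hderiv]
    exact hk.neg.exp.div_const a
  induction k with
  | zero => simpa using huc
  | succ k ih =>
    -- If `u` is `C^k`, then `H` and its inverse are `C^(k+1)`, hence so is the inhomogeneous term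
    -- of the equation for `u ∘ H⁻¹`. This gains one derivative for `u`.
    have hFk : ContDiff ℝ (k + 1) F := hF.of_le (by push_cast; exact le_self_add)
    have hHk : ContDiff ℝ (k + 1) H := by
      rw [contDiff_succ_iff_deriv]
      refine ⟨fun t => (hH t).differentiableAt, by simp, ?_⟩
      rw [hderiv]
      exact (ih hFk).neg.exp.div_const a
    have hsymm : ContDiff ℝ (k + 1) H.symm :=
      H.contDiff_symm_deriv (fun t => (div_pos (Real.exp_pos _) ha).ne') hH hHk
    have hφ := h.contDiff_log_deriv hF
    have hG : ∀ x, G (H.symm x) = H.symm (x / d) := by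
      intro x
      apply H.injective
      have := hHF (G (H.symm x))
      rw [h.right_inv, H.apply_symm_apply] at this
      rw [H.apply_symm_apply, eq_div_iff (by positivity), mul_comm, ← this]
    have hdiv : ContDiff ℝ (k + 1) fun x : ℝ => H.symm (x / d) :=
      hsymm.comp (contDiff_id.div_const _)
    have hcoh := contDiff_of_eq_add_mul_comp_div hd1 (k + 1) 1 (by simp)
      (fun x => Real.log (deriv F (H.symm (x / d))) - Real.log (deriv F p)) (fun x => u (H.symm x))
      ((hφ.comp (by exact_mod_cast hdiv)).sub contDiff_const)
      (huc.comp H.symm.continuous) (fun x => by rw [hu, hG, one_mul])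
    have : u = (fun x => u (H.symm x)) ∘ H := by ext t; simp
    rw [this]
    exact hcoh.comp (by exact_mod_cast hHk)

theorem exists_smooth_conjugacy (h : IsExpandingLift d c F G) (hd : 2 ≤ d) {r : ℕ∞} (hr : 1 ≤ r)
    (hF : ContDiff ℝ (r : WithTop ℕ∞) F)
    (hreg : ∀ t, ∃ χ : ℝ, Tendsto
      (fun n : ℕ => 1 / (n : ℝ) * birkhoffSum F (fun t => Real.log (deriv F t)) n t)
      atTop (𝓝 χ)) :
    ∃ H : ℝ ≃ₜ ℝ, ContDiff ℝ (r : WithTop ℕ∞) H ∧ ContDiff ℝ (r : WithTop ℕ∞) H.symm ∧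
      (∀ t, H (t + 1) = H t + 1) ∧ ∀ t, H (F t) = d * H t := by
  obtain ⟨p, hp⟩ := h.exists_fixed
  obtain ⟨u, huc, hup, hu⟩ := h.exists_continuous_transfer hp
  have hu1 := h.transfer_add_one hreg hp huc hup hu
  obtain ⟨H, a, ha, hH, hH1, hHF⟩ := h.exists_linearization hp huc hu hu1
  have hHr : ContDiff ℝ (r : WithTop ℕ∞) H := by
    have hsucc : ∀ m : ℕ, ((m + 1 : ℕ) : ℕ∞) ≤ r → ContDiff ℝ (m + 1 : ℕ) H := fun m hm => by
      push_cast
      refine h.contDiff_linearization hd huc hu ha hH hHF m (hF.of_le ?_)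
      exact_mod_cast hm
    rw [contDiff_iff_forall_nat_le]
    intro m hm
    cases m with
    | zero => exact (hsucc 0 (by simpa using hr)).of_le (by simp)
    | succ m => exact hsucc m hm
  exact ⟨H, hHr, H.contDiff_symm_deriv (fun t => (div_pos (Real.exp_pos _) ha).ne') hH hHr, hH1, hHF⟩

end IsExpandingLift

/-! ### Lifts of circle maps -/

namespace IsCircleLift

variable {F : ℝ → ℝ} {f : UnitAddCircle → UnitAddCircle}

theorem iterate (h : IsCircleLift F f) (n : ℕ) : IsCircleLift F^[n] f^[n] := by
  refine ⟨h.1.iterate n, fun t => ?_⟩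
  induction n with
  | zero => rfl
  | succ n ih => rw [Function.iterate_succ_apply', Function.iterate_succ_apply', h.2, ih]

theorem circleDeriv_eq (h : IsCircleLift F f) (t : ℝ) :
    circleDeriv f (t : UnitAddCircle) = deriv F t := by
  have hev : (fun s : ℝ => (AddCircle.equivIoc (1 : ℝ) (-1 / 2)
      (f ((t : UnitAddCircle) + (s : UnitAddCircle)) - f t) : ℝ)) =ᶠ[𝓝 0]
      fun s => F (t + s) - F t := by
    have hc : Continuous fun s => F (t + s) - F t := by
      have := h.1; fun_prop
    have hnear : ∀ᶠ s in 𝓝 (0 : ℝ), F (t + s) - F t ∈ Set.Ioo (-1 / 2 : ℝ) (1 / 2) :=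
      hc.continuousAt.eventually_mem (isOpen_Ioo.mem_nhds (by norm_num))
    filter_upwards [hnear] with s hs
    rw [← AddCircle.coe_add, ← h.2, ← h.2, ← AddCircle.coe_sub,
      AddCircle.equivIoc_coe_of_mem]
    exact ⟨hs.1, by linarith [hs.2]⟩
  unfold circleDeriv
  rw [hev.deriv_eq, deriv_sub_const, deriv_comp_const_add, add_zero]

/-- Two lifts of the same circle map differ by an integer constant. -/
theorem exists_int_sub {F' : ℝ → ℝ} (h : IsCircleLift F f) (h' : IsCircleLift F' f) :
    ∃ m : ℤ, ∀ t, F' t = F t + m := by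
  have hint : ∀ t, ∃ m : ℤ, F' t - F t = m := by
    intro t
    have h1 : ((F' t - F t : ℝ) : UnitAddCircle) = 0 := by
      rw [AddCircle.coe_sub, h.2, h'.2, sub_self]
    obtain ⟨m, hm⟩ := (AddCircle.coe_eq_zero_iff 1).1 h1
    exact ⟨m, by rw [← hm]; simp⟩
  choose m hm using hint
  have hcm : Continuous m := by
    rw [Int.isClosedEmbedding_coe_real.isInducing.continuous_iff]
    exact (h'.1.sub h.1).congr hm
  refine ⟨m 0, fun t => ?_⟩
  have := hm t
  rw [(PreconnectedSpace.constant inferInstance hcm : m t = m 0)] at this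
  linarith

theorem exists_degree (h : IsCircleLift F f) : ∃ m : ℤ, ∀ t, F (t + 1) = F t + m := by
  refine h.exists_int_sub (F' := fun t => F (t + 1)) ⟨by have := h.1; fun_prop, fun t => ?_⟩
  rw [h.2, AddCircle.coe_add, AddCircle.coe_period, add_zero]

end IsCircleLift

/-! ### A smooth conjugacy makes every point regular -/

theorem deriv_periodic_of_add_one {F : ℝ → ℝ} {a : ℝ} (h : ∀ t, F (t + 1) = F t + a) :
    Function.Periodic (deriv F) 1 := by
  intro t
  rw [← deriv_comp_add_const, show (fun s => F (s + 1)) = fun s => F s + a from funext h,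
    deriv_add_const]

theorem exists_norm_log_le_of_periodic {g : ℝ → ℝ} (hg : Continuous g) (h0 : ∀ t, g t ≠ 0)
    (hp : Function.Periodic g 1) : ∃ M, ∀ t, ‖Real.log |g t|‖ ≤ M := by
  have hc : Continuous fun t => Real.log |g t| := hg.abs.log fun t => abs_ne_zero.2 (h0 t)
  obtain ⟨M, hM⟩ := (isCompact_Icc (a := (0 : ℝ)) (b := 1)).exists_bound_of_continuousOn
    hc.continuousOn
  refine ⟨M, fun t => ?_⟩
  have h1 := hM (Int.fract t) ⟨Int.fract_nonneg t, (Int.fract_lt_one t).le⟩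
  have h2 := hp.sub_int_mul_eq (x := t) ⌊t⌋
  rw [mul_one, Int.self_sub_floor] at h2
  rwa [h2] at h1

theorem regularPoints_eq_univ_of_conjugate {r : ℕ∞} (hr : 1 ≤ r) {d : ℕ} (hd : 1 ≤ d)
    {f : UnitAddCircle → UnitAddCircle} (hf : CircleContDiff r f)
    (h : CircleConjugate r f (linearExpandingMap d)) : regularPoints f = Set.univ := by
  obtain ⟨F, hF, hFr⟩ := hf
  obtain ⟨h, ⟨H, hH, hHr⟩, ⟨K, hK, hKr⟩, hconj⟩ := h
  have hr' : (r : WithTop ℕ∞) ≠ 0 := by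
    have : r ≠ 0 := (zero_lt_one.trans_le hr).ne'
    exact_mod_cast this
  have hHd := hHr.differentiable hr'
  have hKd := hKr.differentiable hr'
  have hFd := hFr.differentiable hr'
  have hd0 : (d : ℝ) ≠ 0 := by positivity
  -- `K ∘ H` lifts the identity, so it is a translation and has derivative `1`.
  have hne : ∀ t, deriv H t ≠ 0 := by
    have hid : IsCircleLift (fun t => K (H t)) id :=
      ⟨hK.1.comp hH.1, fun t => by rw [hK.2, hH.2, h.symm_apply_apply]; rfl⟩
    have hid' : IsCircleLift (fun t => t) id := ⟨continuous_id, fun t => rfl⟩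
    obtain ⟨m, hm⟩ := hid'.exists_int_sub hid
    intro t h0
    have h1 : HasDerivAt (fun t => K (H t)) (deriv K (H t) * deriv H t) t :=
      HasDerivAt.comp (h₂ := K) t (hKd _).hasDerivAt (hHd t).hasDerivAt
    rw [funext hm] at h1
    have h2 := h1.unique ((hasDerivAt_id' t).add_const (m : ℝ))
    rw [h0] at h2
    simp at h2
  obtain ⟨k, hk⟩ := hH.exists_degree
  obtain ⟨M, hM⟩ := exists_norm_log_le_of_periodic (hHr.continuous_deriv (by exact_mod_cast hr)) hne
    (deriv_periodic_of_add_one hk)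
  have hderiv : ∀ (n : ℕ) (t : ℝ),
      deriv F^[n] (H t) * deriv H t = deriv H ((d : ℝ) ^ n * t) * (d : ℝ) ^ n := by
    intro n t
    have hit : ∀ x, f^[n] (h x) = h (d ^ n • x) := by
      intro x
      induction n with
      | zero => simp
      | succ n ih =>
        rw [Function.iterate_succ_apply', ih]
        have := congrFun hconj (d ^ n • x)
        simp only [Function.comp, linearExpandingMap] at this
        rw [this, smul_smul, pow_succ']
    have hl1 : IsCircleLift (fun t => F^[n] (H t)) (fun x => f^[n] (h x)) :=
      ⟨(hF.iterate n).1.comp hH.1, fun t => by rw [(hF.iterate n).2, hH.2]⟩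
    have hl2 : IsCircleLift (fun t => H ((d : ℝ) ^ n * t)) (fun x => f^[n] (h x)) := by
      refine ⟨by have := hH.1; fun_prop, fun t => ?_⟩
      simp only [hit]
      rw [hH.2, ← AddCircle.coe_nsmul, nsmul_eq_mul]
      push_cast; rfl
    obtain ⟨m, hm⟩ := hl2.exists_int_sub hl1
    have hFn : Differentiable ℝ F^[n] := hFd.iterate n
    have h1 : HasDerivAt (fun t => F^[n] (H t)) (deriv F^[n] (H t) * deriv H t) t :=
      HasDerivAt.comp (h₂ := F^[n]) t (hFn _).hasDerivAt (hHd t).hasDerivAt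
    have h2 : HasDerivAt (fun t => H ((d : ℝ) ^ n * t))
        (deriv H ((d : ℝ) ^ n * t) * (d : ℝ) ^ n) t :=
      HasDerivAt.comp (h₂ := H) t (hHd _).hasDerivAt
        (by simpa using (hasDerivAt_id' t).const_mul ((d : ℝ) ^ n))
    rw [funext hm] at h1
    exact h1.unique (h2.add_const (m : ℝ))
  refine Set.eq_univ_of_forall fun x => ?_
  obtain ⟨t, ht⟩ := QuotientAddGroup.mk_surjective (h.symm x)
  have hx : x = (H t : UnitAddCircle) := by
    rw [hH.2]
    exact (h.apply_symm_apply x).symm.trans (congrArg h ht.symm)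
  refine ⟨Real.log d, ?_⟩
  have hlog : ∀ n : ℕ, Real.log |circleDeriv f^[n] x| =
      n * Real.log d + (Real.log |deriv H ((d : ℝ) ^ n * t)| - Real.log |deriv H t|) := by
    intro n
    rw [hx, (hF.iterate n).circleDeriv_eq]
    have h1 := congrArg (fun y => Real.log |y|) (hderiv n t)
    have h3 : deriv F^[n] (H t) ≠ 0 := by
      intro h0
      have h2 := hderiv n t
      rw [h0, zero_mul] at h2
      exact mul_ne_zero (hne _) (pow_ne_zero n hd0) h2.symm
    simp only [abs_mul] at h1
    rw [Real.log_mul (abs_ne_zero.2 h3) (abs_ne_zero.2 (hne _)),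
      Real.log_mul (abs_ne_zero.2 (hne _)) (abs_ne_zero.2 (pow_ne_zero n hd0)),
      Real.log_abs ((d : ℝ) ^ n), Real.log_pow] at h1
    linarith
  have hz : Tendsto (fun n : ℕ => (1 / (n : ℝ)) *
      (Real.log |deriv H ((d : ℝ) ^ n * t)| - Real.log |deriv H t|)) atTop (𝓝 0) := by
    refine squeeze_zero_norm (fun n => ?_) (tendsto_const_div_atTop_nhds_zero_nat (M + M))
    rw [norm_mul, Real.norm_of_nonneg (by positivity), one_div_mul_eq_div]
    gcongr
    exact (norm_sub_le _ _).trans (add_le_add (hM _) (hM _))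
  have hfin := hz.const_add (Real.log d)
  rw [add_zero] at hfin
  refine hfin.congr' ?_
  filter_upwards [eventually_gt_atTop 0] with n hn
  have : (n : ℝ) ≠ 0 := by positivity
  rw [hlog]
  field_simp

/-! ### Descent to the circle -/

theorem exists_circleHomeomorph {K : ℝ ≃ₜ ℝ} (hK : ∀ t, K (t + 1) = K t + 1) :
    ∃ h : UnitAddCircle ≃ₜ UnitAddCircle, IsCircleLift K h ∧ IsCircleLift K.symm h.symm := by
  have hK' : ∀ t, K.symm (t + 1) = K.symm t + 1 := fun t => by
    rw [K.symm_apply_eq, hK, K.apply_symm_apply]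
  have hper : ∀ {L : ℝ → ℝ}, (∀ t, L (t + 1) = L t + 1) →
      Function.Periodic (fun t => (L t : UnitAddCircle)) 1 := fun {L} hL t => by
    simp only [hL]
    rw [AddCircle.coe_add, AddCircle.coe_period, add_zero]
  refine ⟨{ toFun := (hper hK).lift
            invFun := (hper hK').lift
            left_inv := ?_
            right_inv := ?_
            continuous_toFun := ?_
            continuous_invFun := ?_ }, ⟨K.continuous, fun t => rfl⟩, K.symm.continuous, fun t => rfl⟩
  · rintro ⟨t⟩
    exact congrArg (fun s : ℝ => (s : UnitAddCircle)) (K.symm_apply_apply t)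
  · rintro ⟨t⟩
    exact congrArg (fun s : ℝ => (s : UnitAddCircle)) (K.apply_symm_apply t)
  · exact continuous_quot_lift _ ((AddCircle.continuous_mk' 1).comp K.continuous)
  · exact continuous_quot_lift _ ((AddCircle.continuous_mk' 1).comp K.symm.continuous)

theorem mainTheorem7 (r : ℕ∞) (hr : 2 ≤ r) (d : ℕ) (hd : 2 ≤ d)
    (f : UnitAddCircle → UnitAddCircle) (hf : CircleContDiff r f)
    (hexp : CircleExpanding f) (hor : CircleOrientationPreserving f)
    (hdeg : CircleHasDegree f (d : ℤ)) :
    CircleConjugate r f (linearExpandingMap d) ↔ regularPoints f = Set.univ := by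
  have hr1 : 1 ≤ r := le_trans (by norm_num) hr
  refine ⟨regularPoints_eq_univ_of_conjugate hr1 (by lia) hf, fun hreg => ?_⟩
  obtain ⟨F, hF, hFr⟩ := hf
  have hF2 : ContDiff ℝ 2 F := hFr.of_le (WithTop.coe_le_coe.2 hr)
  obtain ⟨c, hc, hcf⟩ := hexp
  obtain ⟨F₁, hF₁, hmono⟩ := hor
  obtain ⟨F₂, hF₂, hF₂d⟩ := hdeg
  obtain ⟨m₁, hm₁⟩ := hF.exists_int_sub hF₁
  obtain ⟨m₂, hm₂⟩ := hF.exists_int_sub hF₂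
  have hFmono : StrictMono F := fun s t hst => by
    have := hmono hst
    rw [hm₁, hm₁] at this
    linarith
  have hFd : ∀ t, F (t + 1) = F t + d := fun t => by
    have := hF₂d t
    rw [hm₂, hm₂] at this
    push_cast at this
    linarith
  have hlt : ∀ t, c < deriv F t := fun t => by
    have := hcf t
    rwa [hF.circleDeriv_eq, abs_of_nonneg hFmono.monotone.deriv_nonneg] at this
  have hd0 : (0 : ℝ) < d := by positivity
  let e := hFmono.orderIsoOfSurjective F (surjective_of_add_one hF.1 hd0 hFd)
  have hlift : IsExpandingLift d c F e.symm :=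
    ⟨hc, hF2, hFd, hlt, fun t => e.symm_apply_apply t, fun t => e.apply_symm_apply t⟩
  obtain ⟨H, hHr, hHr', hH1, hHF⟩ := hlift.exists_smooth_conjugacy hd hr1 hFr (fun t => by
    have ht : (t : UnitAddCircle) ∈ regularPoints f := hreg ▸ Set.mem_univ _
    obtain ⟨χ, hχ⟩ := ht
    refine ⟨χ, hχ.congr fun n => ?_⟩
    rw [(hF.iterate n).circleDeriv_eq, hlift.log_abs_deriv_iterate])
  obtain ⟨h, hh, hh'⟩ := exists_circleHomeomorph hH1
  -- `H` carries `F` to multiplication by `d`, so the required conjugacy is the inverse of the map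
  -- it induces.
  refine ⟨h.symm, ⟨_, hh', hHr'⟩, ⟨_, hh, hHr⟩, ?_⟩
  funext x
  obtain ⟨t, rfl⟩ := QuotientAddGroup.mk_surjective x
  change f (h.symm (t : UnitAddCircle)) = h.symm (d • (t : UnitAddCircle))
  rw [← AddCircle.coe_nsmul, ← hh'.2, ← hh'.2, ← hF.2]
  congr 1
  rw [H.eq_symm_apply, hHF, H.apply_symm_apply, nsmul_eq_mul]
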